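/- Let $\mathcal X,\mathcal S,\mathcal Y$ be finite alphabets, let $Q$ be a PMF on $\mathcal S$ with $Q(s)>0$ for every $s\in\mathcal S$, and let $W(y|x,s)$ be a transition law from $\mathcal X\times\mathcal S$ to $\mathcal Y$ (a state-dependent discrete memoryless channel). All logarithms are to base $2$, and $-\log 0=+\infty$. For a nonempty finite set $\mathcal M$ and a positive integer $n$, an $(n,\mathcal M)$ zero-error feedback code with causal state information consists of encoding maps $f_i\colon \mathcal M\times\mathcal S^{i}\times\mathcal Y^{i-1}\to\mathcal X$, $1\le i\le n$, and pairwise disjoint decoding sets $\mathcal D_m\subseteq\mathcal Y^n$, $m\in\mathcal M$, such that $$\sum_{y^n\in\mathcal Y^n\setminus\mathcal D_m}\ \prod_{i=1}^n W\bigl(y_i\,\big|\,f_i(m,s^i,y^{i-1}),s_i\bigr)=0\qquad\text{for all } m\in\mathcal M,\ s^n\in\mathcal S^n .$$ A rate $R\in\mathbb R$ is achievable if for every sufficiently large $n$ there exists such a code with $\log|\mathcal M|\ge nR$. The causal-state-information zero-error feedback capacity $C^{\mathrm{caus}}_{\mathrm f,0}$ is the supremum of all achievable rates. Let $\mathcal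 U$ be a finite set with $|\mathcal U|=|\mathcal X|^{|\mathcal S|}$ and let $g\colon\mathcal U\times\mathcal S\to\mathcal X$ be such that $\{g(u,\cdot):u\in\mathcal U\}$ is the set $\mathcal X^{\mathcal S}$ of all functions from $\mathcal S$ to $\mathcal X$. Define $$W'(y|u)=\sum_{s\in\mathcal S}Q(s)\,W\bigl(y\,\big|\,g(u,s),s\bigr),\qquad (u,y)\in\mathcal U\times\mathcal Y,$$ and let $\mathscr P(W')$ be the set of transition laws $P_{Y|U}$ from $\mathcal U$ to $\mathcal Y$ such that $P_{Y|U}(y|u)=0$ whenever $W'(y|u)=0$. **Theorem.** If $C^{\mathrm{caus}}_{\mathrm f,0}>0$, then $$C^{\mathrm{caus}}_{\mathrm f,0}=\max_{P_U}\ \min_{P_{Y|U}\in\mathscr P(W')} I(U;Y)=\max_{P_U}\ \min_{y\in\mathcal Y}\ -\log\sum_{u:\,W'(y|u)>0}P_U(u),$$ where $P_U$ ranges over the PMFs on $\mathcal U$, the mutual information is computed with respect to the joint PMF $P_U(u)P_{Y|U}(y|u)$, and all the maxima and minima are attained. Moreover, $W'(y|u)>0$ if and only if $W(y|g(u,s),s)>0$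 for some $s\in\mathcal S$; consequently a transition law $P_{Y|U}$ belongs to $\mathscr P(W')$ if and only if, for all $(u,y)\in\mathcal U\times\mathcal Y$, $P_{Y|U}(y|u)=0$ whenever $W(y|g(u,s),s)=0$ for every $s\in\mathcal S$. -/

import Mathlib

namespace CausalZeroError

open Filter

noncomputable section

/-- A state-dependent discrete memoryless channel: `W x s` is the PMF of the output given the
input `x` and the state `s`, so that `W x s y` is `W(y|x,s)`. -/
abbrev SDChannel (X S Y : Type*) [Fintype Y] := X → S → stdSimplex ℝ Y

/-- An `(n, M)` feedback code with causal state information at the encoder, where times are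
numbered `0, …, n - 1`: at time `i` the encoder sees the message, the states at the times
`0, …, i`, and the outputs at the times `0, …, i - 1`.  The decoding sets are disjoint. -/
structure CausalCode (X S Y : Type*) (n : ℕ) (M : Type*) where
  enc : (i : Fin n) → M → (Fin (i + 1) → S) → (Fin i → Y) → X
  dec : M → Set (Fin n → Y)
  disjoint : ∀ m m', m ≠ m' → Disjoint (dec m) (dec m')

namespace CausalCode

variable {X S Y M : Type*} {n : ℕ}

/-- The input at time `i`, given the message, the state sequence and the output sequence. -/
def input (c : CausalCode X S Y n M) (m : M) (s : Fin n → S) (y : Fin n → Y) (i : Fin n) : X :=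
  c.enc i m (fun j => s (Fin.castLE i.isLt j)) (fun j => y (Fin.castLE i.isLt.le j))

open Classical in
/-- The conditional probability of a decoding error, given the message and the state sequence. -/
def errorProb [Fintype Y] (W : SDChannel X S Y) (c : CausalCode X S Y n M) (m : M)
    (s : Fin n → S) : ℝ :=
  ∑ y : Fin n → Y with y ∉ c.dec m, ∏ i, W (c.input m s y i) (s i) (y i)

/-- The probability of a decoding error is zero for every message and every state sequence. -/
def IsZeroError [Fintype Y] (W : SDChannel X S Y) (c : CausalCode X S Y n M) : Prop :=
  ∀ (m : M) (s : Fin n → S), c.errorProb W m s = 0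

end CausalCode

/-- Rate `R` is achievable: for every sufficiently large blocklength `n` there is a zero-error
code with a (nonempty, finite) message set of size at least `2 ^ (n R)`. -/
def IsAchievable {X S Y : Type*} [Fintype Y] (W : SDChannel X S Y) (R : ℝ) : Prop :=
  ∀ᶠ n : ℕ in atTop, ∃ (M : Type) (_ : Fintype M) (_ : Nonempty M) (c : CausalCode X S Y n M),
    c.IsZeroError W ∧ n * R ≤ Real.logb 2 (Fintype.card M)

/-- The zero-error feedback capacity with causal state information: the supremum, taken in the
extended reals, of all achievable rates. -/
def capacity {X S Y : Type*} [Fintype Y] (W : SDChannel X S Y) : EReal :=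
  sSup ((fun R : ℝ => (R : EReal)) '' {R | IsAchievable W R})

/-- The channel `W'(y|u) = ∑ s, Q(s) W(y|g(u,s),s)` induced by the Shannon strategies `g`. -/
def inducedChannel {X S Y U : Type*} [Fintype S] [Fintype Y] (Q : stdSimplex ℝ S)
    (W : SDChannel X S Y) (g : U → S → X) (u : U) : stdSimplex ℝ Y :=
  ⟨fun y => ∑ s, Q s * W (g u s) s y, by
    refine ⟨fun y => Finset.sum_nonneg fun s _ => mul_nonneg (Q.2.1 s) ((W (g u s) s).2.1 y), ?_⟩
    rw [Finset.sum_comm]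
    have h : ∀ s, ∑ y, Q s * W (g u s) s y = Q s := fun s => by
      rw [← Finset.mul_sum]
      have h1 : ∑ y, W (g u s) s y = 1 := (W (g u s) s).2.2
      rw [h1, mul_one]
    simp only [h]
    exact Q.2.2⟩

/-- The transition laws `V` with `V(·|u) ≪ W(·|u)` for every `u`. -/
def dominatedBy {U Y : Type*} [Fintype Y] (W : U → stdSimplex ℝ Y) : Set (U → stdSimplex ℝ Y) :=
  {V | ∀ u y, W u y = 0 → V u y = 0}

/-- Mutual information, in bits, of a joint PMF `p` on a finite product, with `0 log 0 = 0`. -/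
def mutualInfo {U Y : Type*} [Fintype U] [Fintype Y] (p : U → Y → ℝ) : ℝ :=
  ∑ u, ∑ y, p u y * Real.logb 2 (p u y / ((∑ y', p u y') * ∑ u', p u' y))

/-- `-log₂ t` for `t ≥ 0`, with `-log₂ 0 = +∞`. -/
def negLog (t : ℝ) : EReal := if t = 0 then ⊤ else ((-Real.logb 2 t : ℝ) : EReal)

/-- `v = max_a min_b f a b`, where for every `a` the minimum over `b` is attained, and so is the
maximum over `a` of these minima. -/
def IsMaxMin {A B : Type*} (f : A → B → EReal) (v : EReal) : Prop :=
  (∀ a, ∃ m, IsLeast (Set.range (f a)) m) ∧ IsGreatest {m | ∃ a, IsLeast (Set.range (f a)) m} v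

end

end CausalZeroError

/-!
For zero-error coding only the relation `E u y`, that the Shannon strategy `u` can produce the
output `y`, matters: a code repeatedly assigns strategies to the messages still compatible with
the outputs, until a single message is left. Let `v` be the value of the zero-sum game with
payoff `1` if `E u y` and `0` otherwise.

If the outputs are drawn independently from an optimal strategy `q`, each message survives each
step with probability at least `v`, so a code of length `n` has at most `v⁻¹ ^ n` messages.
Conversely, assigning strategies to the messages in proportion to an optimal `P` reduces their
number by the factor `v` in every step, up to a rounding error of at most `|U|`, until boundedly
many are left; these are told apart by using a constant number of times a code for two or more
messages, which exists because the capacity is positive.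

For the input PMF `P` every dominated law has mutual information at least `-log v`, by Gibbs'
inequality; the law that conditions `q` on the outputs possible under `u` has mutual information
at most `-log v` for every input PMF.
-/

namespace CausalZeroError

open Filter Matrix

noncomputable section Pmf

variable {U Y : Type*} [Fintype U] [Fintype Y]

theorem nonempty_of_pmf (P : stdSimplex ℝ U) : Nonempty U := by
  by_contra! h
  simpa using stdSimplex.sum_eq_one P

theorem exists_pmf_pos (P : stdSimplex ℝ U) : ∃ u, 0 < P u := by
  by_contra! h
  linarith [Finset.sum_nonpos fun u (_ : u ∈ Finset.univ) => h u, stdSimplex.sum_eq_one P]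

theorem exists_le_of_le_average (P : stdSimplex ℝ U) {f : U → ℝ} {v : ℝ}
    (h : v ≤ ∑ u, P u * f u) : ∃ u, v ≤ f u := by
  by_contra! hlt
  exact h.not_gt ((convex_Iio v).sum_mem (fun u _ => stdSimplex.zero_le P u)
    (stdSimplex.sum_eq_one P) fun u _ => hlt u)

theorem le_average (P : stdSimplex ℝ U) {f : U → ℝ} {v : ℝ} (h : ∀ u, v ≤ f u) :
    v ≤ ∑ u, P u * f u :=
  (convex_Ici v).sum_mem (fun u _ => stdSimplex.zero_le P u) (stdSimplex.sum_eq_one P)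
    fun u _ => h u

theorem average_le (P : stdSimplex ℝ U) {f : U → ℝ} {v : ℝ} (h : ∀ u, f u ≤ v) :
    ∑ u, P u * f u ≤ v :=
  (convex_Iic v).sum_mem (fun u _ => stdSimplex.zero_le P u) (stdSimplex.sum_eq_one P)
    fun u _ => h u

open Classical in
/-- The probability of the event `p` under the PMF `P`. -/
def mass (P : stdSimplex ℝ U) (p : U → Prop) : ℝ :=
  ∑ u with p u, P u

theorem mass_nonneg (P : stdSimplex ℝ U) (p : U → Prop) : 0 ≤ mass P p :=
  Finset.sum_nonneg fun u _ => stdSimplex.zero_le P u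

open Classical in
theorem mass_eq_sum_indicator (P : stdSimplex ℝ U) (p : U → Prop) :
    mass P p = ∑ u, P u * if p u then 1 else 0 := by
  simp [mass, Finset.sum_filter]

theorem mass_pos {P : stdSimplex ℝ U} {p : U → Prop} {u : U} (hP : 0 < P u) (hu : p u) :
    0 < mass P p := by
  classical
  exact Finset.sum_pos' (fun u _ => stdSimplex.zero_le P u) ⟨u, by simpa using hu, hP⟩

theorem sum_mul_mass_comm (P : stdSimplex ℝ U) (q : stdSimplex ℝ Y) (E : U → Y → Prop) :
    ∑ y, q y * mass P (E · y) = ∑ u, P u * mass q (E u) := by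
  simp only [mass_eq_sum_indicator, Finset.mul_sum]
  rw [Finset.sum_comm]
  simp only [mul_left_comm]

end Pmf

section Game

theorem exists_isSaddlePointOn_of_bilinear {E F : Type*}
    [AddCommGroup E] [Module ℝ E] [FiniteDimensional ℝ E] [TopologicalSpace E] [T2Space E]
    [IsTopologicalAddGroup E] [ContinuousSMul ℝ E]
    [AddCommGroup F] [Module ℝ F] [FiniteDimensional ℝ F] [TopologicalSpace F] [T2Space F]
    [IsTopologicalAddGroup F] [ContinuousSMul ℝ F] (B : E →ₗ[ℝ] F →ₗ[ℝ] ℝ)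
    {K : Set E} (hK : IsCompact K) (hK' : Convex ℝ K) (hK₀ : K.Nonempty)
    {L : Set F} (hL : IsCompact L) (hL' : Convex ℝ L) (hL₀ : L.Nonempty) :
    ∃ x ∈ K, ∃ y ∈ L, IsSaddlePointOn K L (fun x y => B x y) x y :=
  Sion.exists_isSaddlePointOn hK₀ hK' hK
    (fun y _ => (B.flip y).continuous_of_finiteDimensional.continuousOn.lowerSemicontinuousOn)
    (fun y _ => ((B.flip y).convexOn hK').quasiconvexOn) hL' hL₀ hL
    (fun x _ => (B x).continuous_of_finiteDimensional.continuousOn.upperSemicontinuousOn)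
    (fun x _ => ((B x).concaveOn hL').quasiconcaveOn)

variable {U Y : Type*} [Fintype U] [Fintype Y]

theorem exists_matrixGame_value [Nonempty U] [Nonempty Y] (a : U → Y → ℝ) :
    ∃ (P : stdSimplex ℝ U) (q : stdSimplex ℝ Y) (v : ℝ),
      (∀ y, ∑ u, P u * a u y ≤ v) ∧ ∀ u, v ≤ ∑ y, q y * a u y := by
  classical
  obtain ⟨P, hP, q, hq, h⟩ := exists_isSaddlePointOn_of_bilinear
    (toLinearMap₂' ℝ (of a))
    (isCompact_stdSimplex ℝ U) (convex_stdSimplex ℝ U)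
    ⟨_, single_mem_stdSimplex ℝ (Classical.arbitrary U)⟩
    (isCompact_stdSimplex ℝ Y) (convex_stdSimplex ℝ Y)
    ⟨_, single_mem_stdSimplex ℝ (Classical.arbitrary Y)⟩
  simp only [toLinearMap₂'_apply'] at h
  refine ⟨⟨P, hP⟩, ⟨q, hq⟩, P ⬝ᵥ of a *ᵥ q, fun y => ?_, fun u => ?_⟩
  · change P ⬝ᵥ (of a)ᵀ y ≤ _
    simpa [mulVec_single_one, col_def] using h P hP _ (single_mem_stdSimplex ℝ y)
  · change _ ≤ q ⬝ᵥ a u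
    simpa [mulVec, dotProduct_comm] using h _ (single_mem_stdSimplex ℝ u) q hq

/-- `P` and `q` are optimal mixed strategies, and `v` is the value, of the zero-sum game in which
one player picks `u`, the other picks `y`, and the first pays `1` to the second if `E u y`. -/
structure IsSaddle (E : U → Y → Prop) (P : stdSimplex ℝ U) (q : stdSimplex ℝ Y) (v : ℝ) :
    Prop where
  mass_le : ∀ y, mass P (E · y) ≤ v
  le_mass : ∀ u, v ≤ mass q (E u)

theorem exists_isSaddle [Nonempty U] [Nonempty Y] (E : U → Y → Prop) :
    ∃ P q v, IsSaddle E P q v := by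
  classical
  obtain ⟨P, q, v, hP, hq⟩ := exists_matrixGame_value fun u y => if E u y then (1 : ℝ) else 0
  exact ⟨P, q, v, by simpa only [mass_eq_sum_indicator] using hP,
    by simpa only [mass_eq_sum_indicator] using hq⟩

variable {E : U → Y → Prop} {P : stdSimplex ℝ U} {q : stdSimplex ℝ Y} {v : ℝ}

theorem IsSaddle.pos (h : IsSaddle E P q v) (hE : ∀ u, ∃ y, E u y) : 0 < v := by
  obtain ⟨u, hu⟩ := exists_pmf_pos P
  obtain ⟨y, hy⟩ := hE u
  exact (mass_pos hu hy).trans_le (h.mass_le y)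

theorem exists_le_mass (hq : ∀ u, v ≤ mass q (E u)) (P' : stdSimplex ℝ U) :
    ∃ y, v ≤ mass P' (E · y) :=
  exists_le_of_le_average q <| (le_average P' hq).trans_eq (sum_mul_mass_comm P' q E).symm

end Game

noncomputable section MutualInfo

variable {U Y : Type*} [Fintype U] [Fintype Y]

/-- The relative entropy of `p` with respect to `q`, in nats. It is meaningful only if `p`
vanishes wherever `q` does; `p y * log (p y / 0)` is `0` here. -/
def relEntropy (p q : stdSimplex ℝ Y) : ℝ :=
  ∑ y, p y * Real.log (p y / q y)

theorem sub_le_mul_log_div {a b : ℝ} (ha : 0 ≤ a) (hb : 0 ≤ b) (hab : b = 0 → a = 0) :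
    a - b ≤ a * Real.log (a / b) := by
  rcases ha.eq_or_lt with rfl | ha
  · simpa using hb
  have hb : 0 < b := hb.lt_of_ne' fun h => ha.ne' (hab h)
  calc a - b = a * (1 - (a / b)⁻¹) := by field_simp
    _ ≤ a * Real.log (a / b) :=
      mul_le_mul_of_nonneg_left (Real.one_sub_inv_le_log_of_pos (div_pos ha hb)) ha.le

/- Gibbs' inequality for `p` and the subprobability `q / v` restricted to the event `r`. -/
theorem le_relEntropy {p q : stdSimplex ℝ Y} (hpq : ∀ y, q y = 0 → p y = 0) {r : Y → Prop}
    (hr : ∀ y, ¬ r y → p y = 0) {v : ℝ} (hv : 0 < v) :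
    1 - mass q r / v - Real.log v ≤ relEntropy p q := by
  classical
  have hterm (y : Y) :
      p y - q y * (if r y then 1 else 0) / v - p y * Real.log v ≤ p y * Real.log (p y / q y) := by
    have hq := stdSimplex.zero_le q y
    by_cases hy : r y ∧ p y ≠ 0
    · have hqy : q y ≠ 0 := mt (hpq y) hy.2
      have h := sub_le_mul_log_div (stdSimplex.zero_le p y) (div_nonneg hq hv.le)
        fun h => hpq y ((div_eq_zero_iff.1 h).resolve_right hv.ne')
      rw [div_div_eq_mul_div, mul_div_right_comm,
        Real.log_mul (div_ne_zero hy.2 hqy) hv.ne', mul_add] at h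
      simp only [hy.1, if_true, mul_one]
      linarith
    · have hp : p y = 0 := by tauto
      have : 0 ≤ q y * (if r y then 1 else 0) / v := by split_ifs <;> positivity
      simpa [hp] using this
  calc 1 - mass q r / v - Real.log v
      = ∑ y, (p y - q y * (if r y then 1 else 0) / v - p y * Real.log v) := by
        simp only [Finset.sum_sub_distrib, ← Finset.sum_div, ← Finset.sum_mul,
          stdSimplex.sum_eq_one, mass_eq_sum_indicator, one_mul]
    _ ≤ relEntropy p q := Finset.sum_le_sum fun y _ => hterm y

theorem relEntropy_nonneg {p q : stdSimplex ℝ Y} (hpq : ∀ y, q y = 0 → p y = 0) :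
    0 ≤ relEntropy p q := by
  simpa [mass] using le_relEntropy hpq (r := fun _ => True) (by simp) one_pos

open Classical in
/-- The PMF `q` conditioned on the event `r`. -/
def condition (q : stdSimplex ℝ Y) (r : Y → Prop) (hr : 0 < mass q r) : stdSimplex ℝ Y :=
  ⟨fun y => (q y * if r y then 1 else 0) / mass q r,
    fun y => div_nonneg (mul_nonneg (stdSimplex.zero_le q y) (by split_ifs <;> simp)) hr.le,
    by rw [← Finset.sum_div, ← mass_eq_sum_indicator, div_self hr.ne']⟩

open Classical in
theorem condition_apply (q : stdSimplex ℝ Y) (r : Y → Prop) (hr : 0 < mass q r) (y : Y) :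
    condition q r hr y = (q y * if r y then 1 else 0) / mass q r :=
  rfl

theorem relEntropy_condition (q : stdSimplex ℝ Y) (r : Y → Prop) (hr : 0 < mass q r) :
    relEntropy (condition q r hr) q = -Real.log (mass q r) := by
  have hterm (y : Y) :
      condition q r hr y * Real.log (condition q r hr y / q y)
        = condition q r hr y * -Real.log (mass q r) := by
    by_cases hy : r y ∧ q y ≠ 0
    · simp [condition_apply, hy.1, div_div_cancel_left' hy.2]
    · have : condition q r hr y = 0 := by grind [condition_apply]
      simp [this]
  simp only [relEntropy, hterm, ← Finset.sum_mul, stdSimplex.sum_eq_one, one_mul]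

/-- The output PMF of the channel `V` when the input has PMF `P`. -/
def outputLaw (P : stdSimplex ℝ U) (V : U → stdSimplex ℝ Y) : stdSimplex ℝ Y :=
  ⟨fun y => ∑ u, P u * V u y,
    fun y => Finset.sum_nonneg fun u _ =>
      mul_nonneg (stdSimplex.zero_le P u) (stdSimplex.zero_le (V u) y),
    by rw [Finset.sum_comm]; simp [← Finset.mul_sum]⟩

theorem outputLaw_apply (P : stdSimplex ℝ U) (V : U → stdSimplex ℝ Y) (y : Y) :
    outputLaw P V y = ∑ u, P u * V u y :=
  rfl

theorem eq_zero_of_outputLaw_eq_zero {P : stdSimplex ℝ U} {V : U → stdSimplex ℝ Y} {u : U}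
    (hu : P u ≠ 0) {y : Y} (hy : outputLaw P V y = 0) : V u y = 0 := by
  rw [outputLaw_apply, Finset.sum_eq_zero_iff_of_nonneg fun u _ =>
    mul_nonneg (stdSimplex.zero_le P u) (stdSimplex.zero_le (V u) y)] at hy
  exact (mul_eq_zero.1 (hy u (Finset.mem_univ u))).resolve_left hu

theorem sum_outputLaw_mul (P : stdSimplex ℝ U) (V : U → stdSimplex ℝ Y) (f : Y → ℝ) :
    ∑ y, outputLaw P V y * f y = ∑ u, P u * ∑ y, V u y * f y := by
  simp only [outputLaw_apply, Finset.sum_mul, Finset.mul_sum, mul_assoc]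
  exact Finset.sum_comm

theorem mutualInfo_eq_sum_relEntropy (P : stdSimplex ℝ U) (V : U → stdSimplex ℝ Y) :
    mutualInfo (fun u y => P u * V u y)
      = (∑ u, P u * relEntropy (V u) (outputLaw P V)) / Real.log 2 := by
  simp only [mutualInfo, relEntropy, ← Finset.mul_sum, stdSimplex.sum_eq_one, mul_one,
    ← outputLaw_apply, Real.logb, mul_assoc, mul_div_assoc', ← Finset.sum_div]
  congr 1
  refine Finset.sum_congr rfl fun u _ => ?_
  rcases eq_or_ne (P u) 0 with hu | hu
  · simp [hu]
  · simp only [mul_div_mul_left _ _ hu]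

/-- `I(U;Y) = H(Y) - H(Y|U)`. -/
theorem mutualInfo_eq_entropy_sub (P : stdSimplex ℝ U) (V : U → stdSimplex ℝ Y) :
    mutualInfo (fun u y => P u * V u y) = (∑ y, Real.negMulLog (outputLaw P V y)
      - ∑ u, P u * ∑ y, Real.negMulLog (V u y)) / Real.log 2 := by
  have hterm (u : U) (y : Y) : P u * (V u y * Real.log (V u y / outputLaw P V y))
      = P u * (V u y * -Real.log (outputLaw P V y)) - P u * Real.negMulLog (V u y) := by
    by_cases h : P u ≠ 0 ∧ V u y ≠ 0
    · rw [Real.log_div h.2 (mt (eq_zero_of_outputLaw_eq_zero h.1) h.2), Real.negMulLog]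
      ring
    · have : P u = 0 ∨ V u y = 0 := by tauto
      rcases this with h | h <;> simp [h]
  have hout : ∑ y, Real.negMulLog (outputLaw P V y)
      = ∑ u, P u * ∑ y, V u y * -Real.log (outputLaw P V y) := by
    rw [← sum_outputLaw_mul]
    simp only [Real.negMulLog, neg_mul_comm]
  simp only [mutualInfo_eq_sum_relEntropy, relEntropy, hout, Finset.mul_sum, hterm,
    Finset.sum_sub_distrib]

theorem continuous_mutualInfo (P : stdSimplex ℝ U) :
    Continuous fun V : U → stdSimplex ℝ Y => mutualInfo fun u y => P u * V u y := by
  have hV (u : U) (y : Y) : Continuous fun V : U → stdSimplex ℝ Y => V u y :=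
    (continuous_apply y).comp (continuous_subtype_val.comp (continuous_apply u))
  simp only [mutualInfo_eq_entropy_sub, outputLaw_apply]
  refine .div_const (.sub ?_ ?_) _
  · exact continuous_finsetSum _ fun y _ => Real.continuous_negMulLog.comp <|
      continuous_finsetSum _ fun u _ => continuous_const.mul (hV u y)
  · exact continuous_finsetSum _ fun u _ => continuous_const.mul <|
      continuous_finsetSum _ fun y _ => Real.continuous_negMulLog.comp (hV u y)

theorem sum_mul_relEntropy_eq_add (P : stdSimplex ℝ U) {V : U → stdSimplex ℝ Y}
    {q : stdSimplex ℝ Y} (hV : ∀ u y, q y = 0 → V u y = 0) :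
    ∑ u, P u * relEntropy (V u) q
      = ∑ u, P u * relEntropy (V u) (outputLaw P V) + relEntropy (outputLaw P V) q := by
  have hterm (u : U) (y : Y) : P u * (V u y * Real.log (V u y / q y))
      = P u * (V u y * Real.log (V u y / outputLaw P V y))
        + P u * (V u y * Real.log (outputLaw P V y / q y)) := by
    by_cases h : P u ≠ 0 ∧ V u y ≠ 0
    · have ho := mt (eq_zero_of_outputLaw_eq_zero h.1) h.2
      rw [← mul_add, ← mul_add, ← Real.log_mul (div_ne_zero h.2 ho)
        (div_ne_zero ho (mt (hV u y) h.2)), div_mul_div_cancel₀ ho]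
    · have : P u = 0 ∨ V u y = 0 := by tauto
      rcases this with h | h <;> simp [h]
  rw [relEntropy, sum_outputLaw_mul]
  simp only [relEntropy, Finset.mul_sum, hterm, Finset.sum_add_distrib]

theorem mutualInfo_le_sum_relEntropy (P : stdSimplex ℝ U) {V : U → stdSimplex ℝ Y}
    {q : stdSimplex ℝ Y} (hV : ∀ u y, q y = 0 → V u y = 0) :
    mutualInfo (fun u y => P u * V u y) ≤ (∑ u, P u * relEntropy (V u) q) / Real.log 2 := by
  have hout : 0 ≤ relEntropy (outputLaw P V) q :=
    relEntropy_nonneg fun y hy => by simp [outputLaw_apply, hV _ y hy]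
  rw [mutualInfo_eq_sum_relEntropy, sum_mul_relEntropy_eq_add P hV]
  gcongr
  linarith

variable {E : U → Y → Prop} {v : ℝ}

theorem neg_logb_le_mutualInfo {P : stdSimplex ℝ U} (hv : 0 < v) (hP : ∀ y, mass P (E · y) ≤ v)
    {V : U → stdSimplex ℝ Y} (hV : ∀ u y, ¬ E u y → V u y = 0) :
    -Real.logb 2 v ≤ mutualInfo fun u y => P u * V u y := by
  set o := outputLaw P V
  have hle : ∑ u, P u * mass o (E u) ≤ v :=
    (sum_mul_mass_comm P o E).symm.trans_le (average_le o hP)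
  rw [mutualInfo_eq_sum_relEntropy, Real.logb, ← neg_div]
  gcongr
  calc -Real.log v ≤ 1 - (∑ u, P u * mass o (E u)) / v - Real.log v := by
        linarith [(div_le_one hv).2 hle]
    _ = ∑ u, P u * (1 - mass o (E u) / v - Real.log v) := by
        simp only [mul_sub, Finset.sum_sub_distrib, ← Finset.sum_mul, Finset.sum_div,
          mul_div_assoc, stdSimplex.sum_eq_one, one_mul, mul_one]
    _ ≤ ∑ u, P u * relEntropy (V u) o := by
        refine Finset.sum_le_sum fun u _ => ?_
        rcases eq_or_ne (P u) 0 with hu | hu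
        · simp [hu]
        · exact mul_le_mul_of_nonneg_left
            (le_relEntropy (fun y => eq_zero_of_outputLaw_eq_zero hu) (hV u) hv)
            (stdSimplex.zero_le P u)

theorem exists_mutualInfo_le_neg_logb {q : stdSimplex ℝ Y} (hv : 0 < v)
    (hq : ∀ u, v ≤ mass q (E u)) :
    ∃ V : U → stdSimplex ℝ Y, (∀ u y, ¬ E u y → V u y = 0) ∧
      ∀ P : stdSimplex ℝ U, mutualInfo (fun u y => P u * V u y) ≤ -Real.logb 2 v := by
  have hpos (u : U) : 0 < mass q (E u) := hv.trans_le (hq u)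
  refine ⟨fun u => condition q (E u) (hpos u), fun u y h => by simp [condition_apply, h],
    fun P => ?_⟩
  refine (mutualInfo_le_sum_relEntropy P (q := q) fun u y h => by
    simp [condition_apply, h]).trans ?_
  rw [Real.logb, ← neg_div]
  gcongr
  refine average_le P fun u => ?_
  rw [relEntropy_condition, neg_le_neg_iff]
  exact Real.log_le_log hv (hq u)

end MutualInfo

section MaxMin

theorem negLog_of_pos {t : ℝ} (ht : 0 < t) : negLog t = ((-Real.logb 2 t : ℝ) : EReal) :=
  if_neg ht.ne'

theorem negLog_le_negLog {s t : ℝ} (hs : 0 ≤ s) (hst : s ≤ t) : negLog t ≤ negLog s := by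
  rcases hs.eq_or_lt with rfl | hs
  · simp [negLog]
  · rw [negLog_of_pos hs, negLog_of_pos (hs.trans_le hst), EReal.coe_le_coe_iff, neg_le_neg_iff]
    exact Real.logb_le_logb_of_le one_lt_two hs hst

theorem IsMaxMin.of_saddle {A B : Type*} {f : A → B → EReal} {v : EReal}
    (hmin : ∀ a, ∃ m, IsLeast (Set.range (f a)) m) {a₀ : A} (ha : ∀ b, v ≤ f a₀ b)
    (hb : ∀ a, ∃ b, f a b ≤ v) : IsMaxMin f v := by
  have hle {a : A} {m : EReal} (hm : IsLeast (Set.range (f a)) m) : m ≤ v :=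
    let ⟨b, hb⟩ := hb a
    (hm.2 ⟨b, rfl⟩).trans hb
  refine ⟨hmin, ⟨a₀, ?_⟩, fun m ⟨_, hm⟩ => hle hm⟩
  obtain ⟨m, hm⟩ := hmin a₀
  obtain ⟨b, rfl⟩ := hm.1
  exact (ha b).antisymm (hle hm) ▸ hm

variable {U Y : Type*} [Fintype Y]

theorem isCompact_dominatedBy (W : U → stdSimplex ℝ Y) : IsCompact (dominatedBy W) := by
  simp only [dominatedBy, Set.ofPred_forall]
  refine IsClosed.isCompact <|
    isClosed_iInter fun u => isClosed_iInter fun y => isClosed_iInter fun _ => isClosed_eq ?_ ?_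
  · exact (continuous_apply y).comp (continuous_subtype_val.comp (continuous_apply u))
  · exact continuous_const

theorem mem_dominatedBy_iff {W V : U → stdSimplex ℝ Y} :
    V ∈ dominatedBy W ↔ ∀ u y, ¬ 0 < W u y → V u y = 0 := by
  simp only [dominatedBy, Set.mem_ofPred_eq, (stdSimplex.zero_le (W _) _).not_lt_iff_eq']

variable [Fintype U]

theorem exists_isLeast_mutualInfo (W : U → stdSimplex ℝ Y) (P : stdSimplex ℝ U) :
    ∃ m, IsLeast (Set.range fun V : dominatedBy W =>
      ((mutualInfo fun u y => P u * V.1 u y : ℝ) : EReal)) m := by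
  have : CompactSpace (dominatedBy W) := isCompact_iff_compactSpace.1 (isCompact_dominatedBy W)
  have : Nonempty (dominatedBy W) := ⟨⟨W, fun _ _ h => h⟩⟩
  exact (isCompact_range (continuous_coe_real_ereal.comp
    ((continuous_mutualInfo P).comp continuous_subtype_val))).exists_isLeast (Set.range_nonempty _)

theorem isMaxMin_mutualInfo {W : U → stdSimplex ℝ Y} {P : stdSimplex ℝ U} {q : stdSimplex ℝ Y}
    {v : ℝ} (hs : IsSaddle (fun u y => 0 < W u y) P q v) :
    IsMaxMin (fun (P : stdSimplex ℝ U) (V : dominatedBy W) =>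
      ((mutualInfo fun u y => P u * V.1 u y : ℝ) : EReal)) ((-Real.logb 2 v : ℝ) : EReal) := by
  have hv : 0 < v := hs.pos fun u => exists_pmf_pos (W u)
  obtain ⟨V, hV, hVle⟩ := exists_mutualInfo_le_neg_logb hv hs.le_mass
  refine .of_saddle (exists_isLeast_mutualInfo W) (a₀ := P) (fun V' => ?_) fun P' => ?_
  · exact EReal.coe_le_coe_iff.2 <|
      neg_logb_le_mutualInfo hv hs.mass_le (mem_dominatedBy_iff.1 V'.2)
  · exact ⟨⟨V, mem_dominatedBy_iff.2 hV⟩, EReal.coe_le_coe_iff.2 (hVle P')⟩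

theorem isMaxMin_negLog_mass {E : U → Y → Prop} {P : stdSimplex ℝ U} {q : stdSimplex ℝ Y}
    {v : ℝ} (hs : IsSaddle E P q v) (hv : 0 ≤ v) :
    IsMaxMin (fun (P : stdSimplex ℝ U) (y : Y) => negLog (mass P (E · y))) (negLog v) := by
  have : Nonempty Y := nonempty_of_pmf q
  refine .of_saddle (fun P' => ?_) (a₀ := P) (fun y => ?_) fun P' => ?_
  · exact (Set.finite_range _).isCompact.exists_isLeast (Set.range_nonempty _)
  · exact negLog_le_negLog (mass_nonneg _ _) (hs.mass_le y)
  · obtain ⟨y, hy⟩ := exists_le_mass hs.le_mass P'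
    exact ⟨y, negLog_le_negLog hv hy⟩

end MaxMin

section FeedbackGame

variable {U Y M N : Type*} {E : U → Y → Prop}

open Classical in
/-- A sender who has one of the messages in `A` and uses a channel `n` times, with feedback, can
ensure that the set of messages compatible with the outputs ends up satisfying `T`. Only the
support `E` of the channel matters: `E u y` says that the input `u` can produce the output `y`. -/
def CanReduce (E : U → Y → Prop) (T : Finset M → Prop) : ℕ → Finset M → Prop
  | 0, A => T A
  | n + 1, A => ∃ φ : M → U, ∀ y, CanReduce E T n {m ∈ A | E (φ m) y}

theorem CanReduce.mono {T T' : Finset M → Prop} (h : ∀ A, T A → T' A) {n : ℕ}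
    {A : Finset M} (hA : CanReduce E T n A) : CanReduce E T' n A := by
  induction n generalizing A with
  | zero => exact h A hA
  | succ n ih =>
    obtain ⟨φ, hφ⟩ := hA
    exact ⟨φ, fun y => ih (hφ y)⟩

theorem CanReduce.trans {T : Finset M → Prop} {k n : ℕ} {A : Finset M}
    (hA : CanReduce E (CanReduce E T k) n A) : CanReduce E T (k + n) A := by
  induction n generalizing A with
  | zero => exact hA
  | succ n ih =>
    obtain ⟨φ, hφ⟩ := hA
    exact ⟨φ, fun y => ih (hφ y)⟩

open Classical in
theorem CanReduce.comap {T : Finset M → Prop} {T' : Finset N → Prop} (π : N → M) (B : Finset N)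
    (h : ∀ A, T A → T' {b ∈ B | π b ∈ A}) {n : ℕ} {A : Finset M} (hA : CanReduce E T n A) :
    CanReduce E T' n {b ∈ B | π b ∈ A} := by
  induction n generalizing A with
  | zero => exact h A hA
  | succ n ih =>
    obtain ⟨φ, hφ⟩ := hA
    refine ⟨φ ∘ π, fun y => ?_⟩
    convert ih (hφ y) using 1
    ext b
    simp [and_assoc]

theorem exists_card_fiber_le [Fintype U] [Nonempty U] [DecidableEq U] (A : Finset M) (c : U → ℕ)
    (hc : A.card ≤ ∑ u, c u) : ∃ φ : M → U, ∀ u, {m ∈ A | φ m = u}.card ≤ c u := by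
  let C : Finset (Σ _ : U, ℕ) := Finset.univ.sigma fun u => Finset.range (c u)
  have hAC : (A : Set M).encard ≤ (C : Set (Σ _ : U, ℕ)).encard := by
    simp only [C, Set.encard_coe_eq_coe_finsetCard, Finset.card_sigma, Finset.card_range]
    exact_mod_cast hc
  obtain ⟨f, hf, hinj⟩ := A.finite_toSet.exists_injOn_of_encard_le hAC
  refine ⟨fun m => (f m).1, fun u => ?_⟩
  rw [← Finset.card_range (c u)]
  refine Finset.card_le_card_of_injOn (fun m => (f m).2) (fun m hm => ?_) fun m hm m' hm' h => ?_
  · obtain ⟨hmA, rfl⟩ := Finset.mem_filter.1 hm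
    simpa [C] using hf hmA
  · obtain ⟨hmA, hmu⟩ := Finset.mem_filter.1 hm
    obtain ⟨hmA', hmu'⟩ := Finset.mem_filter.1 hm'
    exact hinj hmA hmA' (Sigma.ext (hmu.trans hmu'.symm) (heq_of_eq h))

theorem canReduce_of_card_le_pow [Fintype M] [Nonempty M] {k : ℕ}
    (hM : CanReduce E (fun A : Finset M => A.card ≤ 1) k Finset.univ) (t : ℕ)
    {B : Finset N} (hB : B.card ≤ Fintype.card M ^ t) :
    CanReduce E (fun B : Finset N => B.card ≤ 1) (t * k) B := by
  classical
  induction t generalizing B with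
  | zero => simpa [CanReduce] using hB
  | succ t ih =>
    obtain ⟨π, hπ⟩ := exists_card_fiber_le B (fun _ : M => Fintype.card M ^ t) <| by
      simpa [pow_succ'] using hB
    have hsplit (A : Finset M) (hA : A.card ≤ 1) :
        CanReduce E (fun B : Finset N => B.card ≤ 1) (t * k) {b ∈ B | π b ∈ A} := by
      obtain ⟨m, hm⟩ := Finset.card_le_one_iff_subset_singleton.1 hA
      refine ih ((Finset.card_le_card ?_).trans (hπ m))
      exact Finset.monotone_filter_right B fun b _ hb => Finset.mem_singleton.1 (hm hb)
    simpa [add_mul] using (hM.comap π B hsplit).trans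

open Classical in
theorem card_mul_le_sum_card_filter [Fintype Y] {q : stdSimplex ℝ Y} {v : ℝ}
    (hq : ∀ u, v ≤ mass q (E u)) (A : Finset M) (φ : M → U) :
    A.card * v ≤ ∑ y, q y * {m ∈ A | E (φ m) y}.card := by
  calc A.card * v = ∑ _ ∈ A, v := by simp
    _ ≤ ∑ m ∈ A, mass q (E (φ m)) := Finset.sum_le_sum fun m _ => hq _
    _ = ∑ y, q y * {m ∈ A | E (φ m) y}.card := by
      simp only [mass_eq_sum_indicator]
      rw [Finset.sum_comm]
      simp only [← Finset.mul_sum, Finset.sum_boole]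

theorem CanReduce.card_mul_pow_le [Fintype Y] {q : stdSimplex ℝ Y} {v : ℝ} (hv : 0 ≤ v)
    (hq : ∀ u, v ≤ mass q (E u)) {b : ℝ} {n : ℕ} {A : Finset M}
    (hA : CanReduce E (fun A : Finset M => (A.card : ℝ) ≤ b) n A) : A.card * v ^ n ≤ b := by
  classical
  induction n generalizing A with
  | zero => simpa [CanReduce] using hA
  | succ n ih =>
    obtain ⟨φ, hφ⟩ := hA
    calc A.card * v ^ (n + 1) = A.card * v * v ^ n := by ring
      _ ≤ (∑ y, q y * {m ∈ A | E (φ m) y}.card) * v ^ n :=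
        mul_le_mul_of_nonneg_right (card_mul_le_sum_card_filter hq A φ) (pow_nonneg hv n)
      _ = ∑ y, q y * ({m ∈ A | E (φ m) y}.card * v ^ n) := by
        simp only [Finset.sum_mul, mul_assoc]
      _ ≤ b := average_le q fun y => ih (hφ y)

open Classical in
theorem exists_card_filter_le [Fintype U] {P : stdSimplex ℝ U} {v : ℝ}
    (hP : ∀ y, mass P (E · y) ≤ v) (A : Finset M) :
    ∃ φ : M → U, ∀ y, ({m ∈ A | E (φ m) y}.card : ℝ) ≤ v * A.card + Fintype.card U := by
  have : Nonempty U := nonempty_of_pmf P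
  have hceil : A.card ≤ ∑ u, ⌈P u * A.card⌉₊ := by
    rw [← Nat.cast_le (α := ℝ), Nat.cast_sum]
    calc (A.card : ℝ) = ∑ u, P u * A.card := by
          rw [← Finset.sum_mul, stdSimplex.sum_eq_one, one_mul]
      _ ≤ ∑ u, (⌈P u * A.card⌉₊ : ℝ) := Finset.sum_le_sum fun u _ => Nat.le_ceil _
  obtain ⟨φ, hφ⟩ := exists_card_fiber_le A _ hceil
  have hfiber (u : U) : ({m ∈ A | φ m = u}.card : ℝ) ≤ P u * A.card + 1 :=
    (Nat.cast_le.2 (hφ u)).trans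
      (Nat.ceil_lt_add_one (mul_nonneg (stdSimplex.zero_le P u) (Nat.cast_nonneg _))).le
  refine ⟨φ, fun y => ?_⟩
  have hfilter : ({m ∈ A | E (φ m) y}.card : ℝ) = ∑ u with E u y, ({m ∈ A | φ m = u}.card : ℝ) := by
    rw [Finset.card_eq_sum_card_fiberwise (f := φ) (t := {u | E u y}) (by simp [Set.MapsTo]),
      Nat.cast_sum]
    refine Finset.sum_congr rfl fun u hu => ?_
    congr 2
    grind
  calc ({m ∈ A | E (φ m) y}.card : ℝ) = ∑ u with E u y, ({m ∈ A | φ m = u}.card : ℝ) := hfilter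
    _ ≤ ∑ u with E u y, (P u * A.card + 1) := Finset.sum_le_sum fun u _ => hfiber u
    _ = mass P (E · y) * A.card + ({u | E u y} : Finset U).card := by
      simp [Finset.sum_add_distrib, Finset.sum_mul, mass]
    _ ≤ v * A.card + Fintype.card U := by
      gcongr
      · exact hP y
      · exact Finset.card_le_univ _

theorem canReduce_card_le [Fintype U] {P : stdSimplex ℝ U} {v : ℝ} (hv₀ : 0 ≤ v) (hv₁ : v < 1)
    (hP : ∀ y, mass P (E · y) ≤ v) (n : ℕ) {a : ℝ} {A : Finset M}
    (hA : A.card ≤ a + Fintype.card U / (1 - v)) :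
    CanReduce E (fun A : Finset M => A.card ≤ v ^ n * a + Fintype.card U / (1 - v)) n A := by
  classical
  induction n generalizing A a with
  | zero => simpa [CanReduce] using hA
  | succ n ih =>
    obtain ⟨φ, hφ⟩ := exists_card_filter_le hP A
    refine ⟨φ, fun y => ?_⟩
    rw [pow_succ, mul_assoc]
    refine ih ((hφ y).trans ?_)
    -- `|U| / (1 - v)` is the fixed point of `t ↦ v * t + |U|`.
    calc v * A.card + Fintype.card U
        ≤ v * (a + Fintype.card U / (1 - v)) + Fintype.card U := by gcongr
      _ = v * a + Fintype.card U / (1 - v) := by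
        have : 1 - v ≠ 0 := by linarith
        field_simp
        ring

end FeedbackGame

section Codes

variable {X S Y U M : Type*}

/-- The encoding maps of a `CausalCode`, without decoding sets. -/
abbrev CausalEncoder (X S Y : Type*) (n : ℕ) (M : Type*) :=
  (i : Fin n) → M → (Fin (i + 1) → S) → (Fin i → Y) → X

namespace CausalEncoder

variable {n : ℕ}

/-- The encoder that uses the strategy `φ m` at time `0`, and then acts as the encoder assigned
to the first output. -/
def cons (φ : M → S → X) (f : Y → CausalEncoder X S Y n M) : CausalEncoder X S Y (n + 1) M :=
  Fin.cases (fun m s _ => φ m (s 0)) fun i m s y =>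
    f (y (0 : Fin (i + 1))) i m (Fin.tail (n := i + 1) s) (Fin.tail (n := i) y)

/-- The strategy that an encoder uses at time `0`. -/
def head (f : CausalEncoder X S Y (n + 1) M) (m : M) (s : S) : X :=
  f 0 m (fun _ => s) Fin.elim0

/-- What remains of an encoder after time `0` if the state was `s₀ m` and the output was `y₀`. -/
def tail (f : CausalEncoder X S Y (n + 1) M) (s₀ : M → S) (y₀ : Y) : CausalEncoder X S Y n M :=
  fun i m s y => f i.succ m (Fin.cons (s₀ m) s) (Fin.cons y₀ y)

end CausalEncoder

variable [Fintype Y]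

/-- Under the Shannon strategy `g u`, the output is `y` with positive probability in some state. -/
def CanOutput (W : SDChannel X S Y) (g : U → S → X) (u : U) (y : Y) : Prop :=
  ∃ s, 0 < W (g u s) s y

/-- The outputs `y` have positive probability in some state sequence when `m` is sent. -/
def Compatible (W : SDChannel X S Y) {n : ℕ} (f : CausalEncoder X S Y n M) (y : Fin n → Y)
    (m : M) : Prop :=
  ∃ s : Fin n → S, ∀ i, 0 < W (f i m (fun j => s (Fin.castLE i.isLt j))
    fun j => y (Fin.castLE i.isLt.le j)) (s i) (y i)

variable {W : SDChannel X S Y} {n : ℕ}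

theorem compatible_zero (f : CausalEncoder X S Y 0 M) (y : Fin 0 → Y) (m : M) :
    Compatible W f y m :=
  ⟨Fin.elim0, fun i => i.elim0⟩

theorem compatible_cons_iff {φ : M → S → X} {f : Y → CausalEncoder X S Y n M}
    {y : Fin (n + 1) → Y} {m : M} :
    Compatible W (CausalEncoder.cons φ f) y m ↔
      (∃ s, 0 < W (φ m s) s (y 0)) ∧ Compatible W (f (y 0)) (Fin.tail y) m := by
  constructor
  · rintro ⟨s, hs⟩
    exact ⟨⟨s 0, hs 0⟩, Fin.tail s, fun i => hs i.succ⟩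
  · rintro ⟨⟨s₀, h₀⟩, s, hs⟩
    exact ⟨Fin.cons s₀ s, Fin.cases h₀ hs⟩

theorem compatible_of_tail {f : CausalEncoder X S Y (n + 1) M} {s₀ : M → S} {y₀ : Y} {m : M}
    (h₀ : 0 < W (f.head m (s₀ m)) (s₀ m) y₀) {y : Fin n → Y}
    (h : Compatible W (f.tail s₀ y₀) y m) : Compatible W f (Fin.cons y₀ y) m := by
  obtain ⟨s, hs⟩ := h
  refine ⟨Fin.cons (s₀ m) s, Fin.cases ?_ fun i => ?_⟩
  · convert h₀ using 4
    · refine congrArg₂ (f 0 m) (funext fun (j : Fin 1) => ?_) (funext fun j => j.elim0)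
      rw [Subsingleton.elim j 0]
      rfl
    all_goals rfl
  · convert hs i using 4
    · exact congrArg₂ (f i.succ m)
        (funext fun (j : Fin (i + 1 + 1)) => by cases j using Fin.cases <;> rfl)
        (funext fun (j : Fin (i + 1)) => by cases j using Fin.cases <;> rfl)
    all_goals rfl

open Classical in
theorem canReduce_of_encoder [Nonempty S] {g : U → S → X} (hg : Function.Surjective g)
    {T : Finset M → Prop} (hT : Antitone T) {f : CausalEncoder X S Y n M} {A : Finset M}
    (hf : ∀ y, T {m ∈ A | Compatible W f y m}) : CanReduce (CanOutput W g) T n A := by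
  induction n generalizing A with
  | zero => simpa [CanReduce, compatible_zero] using hf Fin.elim0
  | succ n ih =>
    choose φ hφ using fun m => hg (f.head m)
    refine ⟨φ, fun y₀ => ?_⟩
    have hstate (m : M) : ∃ s, CanOutput W g (φ m) y₀ → 0 < W (f.head m s) s y₀ := by
      rw [CanOutput, hφ]
      exact ⟨Classical.epsilon fun s => 0 < W (f.head m s) s y₀, fun h => Classical.epsilon_spec h⟩
    choose s₀ hs₀ using hstate
    refine ih (f := f.tail s₀ y₀) fun y => hT ?_ (hf (Fin.cons y₀ y))
    rw [Finset.filter_filter]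
    exact Finset.monotone_filter_right A fun m _ hm => compatible_of_tail (hs₀ m hm.1) hm.2

open Classical in
theorem exists_encoder_of_canReduce [Nonempty X] {g : U → S → X} {T : Finset M → Prop}
    {A : Finset M} (h : CanReduce (CanOutput W g) T n A) :
    ∃ f : CausalEncoder X S Y n M, ∀ y, T {m ∈ A | Compatible W f y m} := by
  induction n generalizing A with
  | zero => exact ⟨fun i => i.elim0, fun y => by simpa [CanReduce, compatible_zero] using h⟩
  | succ n ih =>
    obtain ⟨φ, hφ⟩ := h
    choose f hf using fun y => ih (hφ y)
    refine ⟨.cons (fun m => g (φ m)) f, fun y => ?_⟩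
    simpa only [compatible_cons_iff, Finset.filter_filter] using! hf (y 0) (Fin.tail y)

theorem CausalCode.isZeroError_iff {c : CausalCode X S Y n M} :
    c.IsZeroError W ↔ ∀ m y, Compatible W c.enc y m → y ∈ c.dec m := by
  classical
  have herror (m : M) (s : Fin n → S) :
      c.errorProb W m s = 0 ↔ ∀ y, (∀ i, 0 < W (c.input m s y i) (s i) (y i)) → y ∈ c.dec m := by
    rw [errorProb, Finset.sum_eq_zero_iff_of_nonneg fun y _ =>
      Finset.prod_nonneg fun i _ => stdSimplex.zero_le _ _]
    refine forall_congr' fun y => ?_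
    have hprod : (∀ i, 0 < W (c.input m s y i) (s i) (y i)) ↔
        ∏ i, W (c.input m s y i) (s i) (y i) ≠ 0 := by
      simp [Finset.prod_ne_zero_iff, (stdSimplex.zero_le (W _ _) _).lt_iff_ne']
    rw [hprod, Finset.mem_filter, and_iff_right (Finset.mem_univ y), not_imp_comm]
  simp only [IsZeroError, herror, Compatible, forall_exists_index]
  exact forall_congr' fun m => forall_comm

open Classical in
theorem CausalCode.IsZeroError.canReduce [Nonempty S] [Fintype M] {g : U → S → X}
    (hg : Function.Surjective g) {c : CausalCode X S Y n M} (hc : c.IsZeroError W) :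
    CanReduce (CanOutput W g) (fun A : Finset M => A.card ≤ 1) n Finset.univ := by
  refine canReduce_of_encoder hg (fun A B hAB => (Finset.card_le_card hAB).trans) (f := c.enc)
    fun y => Finset.card_le_one.2 fun m hm m' hm' => ?_
  have hdec {m : M} (hm : m ∈ ({m | Compatible W c.enc y m} : Finset M)) : y ∈ c.dec m :=
    isZeroError_iff.1 hc m y (Finset.mem_filter.1 hm).2
  by_contra hne
  exact Set.disjoint_left.1 (c.disjoint m m' hne) (hdec hm) (hdec hm')

theorem exists_isZeroError_of_canReduce [Nonempty X] [Fintype M] {g : U → S → X}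
    (h : CanReduce (CanOutput W g) (fun A : Finset M => A.card ≤ 1) n Finset.univ) :
    ∃ c : CausalCode X S Y n M, c.IsZeroError W := by
  classical
  obtain ⟨f, hf⟩ := exists_encoder_of_canReduce h
  have hdisj (m m' : M) (hne : m ≠ m') :
      Disjoint {y | Compatible W f y m} {y | Compatible W f y m'} :=
    Set.disjoint_left.2 fun y hy hy' =>
      hne <| Finset.card_le_one.1 (hf y) m (by simpa using hy) m' (by simpa using hy')
  exact ⟨⟨f, fun m => {y | Compatible W f y m}, hdisj⟩,
    CausalCode.isZeroError_iff.2 fun _ _ hy => hy⟩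

end Codes

section Capacity

variable {X S Y U : Type*} [Fintype Y] {W : SDChannel X S Y} {g : U → S → X} {v : ℝ}

theorem inducedChannel_pos_iff [Fintype S] {Q : stdSimplex ℝ S} (hQ : ∀ s, 0 < Q s) (u : U)
    (y : Y) : 0 < inducedChannel Q W g u y ↔ CanOutput W g u y := by
  change 0 < ∑ s, Q s * W (g u s) s y ↔ ∃ s, 0 < W (g u s) s y
  rw [Finset.sum_pos_iff_of_nonneg fun s _ => mul_nonneg (hQ s).le (stdSimplex.zero_le _ y)]
  simp [hQ]

theorem exists_code_of_capacity_pos (h : 0 < capacity W) :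
    ∃ n : ℕ, 0 < n ∧ ∃ (M : Type) (_ : Fintype M) (_ : Nontrivial M) (c : CausalCode X S Y n M),
      c.IsZeroError W := by
  obtain ⟨_, ⟨R, hR, rfl⟩, hpos⟩ := lt_sSup_iff.1 h
  obtain ⟨n, ⟨M, _, _, c, hc, hn⟩, hn₀⟩ := (hR.and (eventually_gt_atTop 0)).exists
  have hlog : 0 < Real.logb 2 (Fintype.card M) :=
    (mul_pos (Nat.cast_pos.2 hn₀) (EReal.coe_pos.1 hpos)).trans_le hn
  have hcard : 1 < Fintype.card M :=
    Nat.one_lt_cast.1 ((Real.logb_pos_iff one_lt_two (by positivity)).1 hlog)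
  exact ⟨n, hn₀, M, ‹_›, Fintype.one_lt_card_iff_nontrivial.1 hcard, c, hc⟩

theorem nonempty_of_capacity_pos [Nonempty S] (h : 0 < capacity W) : Nonempty X := by
  obtain ⟨n, hn, M, _, _, c, -⟩ := exists_code_of_capacity_pos h
  exact ⟨c.enc ⟨0, hn⟩ (Classical.arbitrary M) (fun _ => Classical.arbitrary S) Fin.elim0⟩

section Converse

variable [Nonempty S] {q : stdSimplex ℝ Y}

theorem CausalCode.IsZeroError.card_mul_pow_le (hg : Function.Surjective g) (hv : 0 ≤ v)
    (hq : ∀ u, v ≤ mass q (CanOutput W g u)) {M : Type*} [Fintype M] {n : ℕ}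
    {c : CausalCode X S Y n M} (hc : c.IsZeroError W) : Fintype.card M * v ^ n ≤ 1 :=
  ((hc.canReduce hg).mono fun _ hA => Nat.cast_le_one.2 hA).card_mul_pow_le hv hq

theorem CausalCode.IsZeroError.lt_one (hg : Function.Surjective g) (hv : 0 ≤ v)
    (hq : ∀ u, v ≤ mass q (CanOutput W g u)) {M : Type*} [Finite M] [Nontrivial M] {n : ℕ}
    {c : CausalCode X S Y n M} (hc : c.IsZeroError W) : v < 1 := by
  have := Fintype.ofFinite M
  by_contra! h
  have hM : (1 : ℝ) < Fintype.card M := Nat.one_lt_cast.2 Fintype.one_lt_card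
  nlinarith [hc.card_mul_pow_le hg hv hq, one_le_pow₀ h (n := n)]

theorem IsAchievable.le_neg_logb (hg : Function.Surjective g) (hv : 0 < v)
    (hq : ∀ u, v ≤ mass q (CanOutput W g u)) {R : ℝ} (hR : IsAchievable W R) :
    R ≤ -Real.logb 2 v := by
  obtain ⟨n, ⟨M, _, _, c, hc, hn⟩, hn₀⟩ := (hR.and (eventually_gt_atTop 0)).exists
  have hn₀ : (0 : ℝ) < n := Nat.cast_pos.2 hn₀
  have hM : (0 : ℝ) < Fintype.card M := Nat.cast_pos.2 Fintype.card_pos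
  refine le_of_mul_le_mul_left (hn.trans ?_) hn₀
  calc Real.logb 2 (Fintype.card M) ≤ Real.logb 2 (1 / v ^ n) :=
        Real.logb_le_logb_of_le one_lt_two hM <|
          (le_div_iff₀ (pow_pos hv n)).2 (hc.card_mul_pow_le hg hv.le hq)
    _ = n * -Real.logb 2 v := by rw [one_div, Real.logb_inv, Real.logb_pow, mul_neg]

end Converse

section Achievability

theorem logb_sub_one_le_logb_floor {x : ℝ} (hx : 1 ≤ x) :
    Real.logb 2 x - 1 ≤ Real.logb 2 ⌊x⌋₊ := by
  have hfloor : (1 : ℝ) ≤ ⌊x⌋₊ := Nat.one_le_cast.2 (Nat.le_floor (mod_cast hx))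
  calc Real.logb 2 x - 1 = Real.logb 2 (x / 2) := by
        rw [Real.logb_div (by positivity) two_ne_zero, Real.logb_self_eq_one one_lt_two]
    _ ≤ Real.logb 2 ⌊x⌋₊ :=
        Real.logb_le_logb_of_le one_lt_two (by positivity) (by linarith [Nat.lt_floor_add_one x])

theorem isAchievable_of_forall_exists_code {b : ℝ} (hb : 1 ≤ b) {d : ℕ}
    (h : ∀ l, ∃ c : CausalCode X S Y (d + l) (Fin ⌊b ^ l⌋₊), c.IsZeroError W) {R : ℝ}
    (hR : R < Real.logb 2 b) : IsAchievable W R := by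
  have hlim : Tendsto (fun n : ℕ => n * (Real.logb 2 b - R)) atTop atTop :=
    tendsto_natCast_atTop_atTop.atTop_mul_const (sub_pos.2 hR)
  filter_upwards [eventually_ge_atTop d,
    hlim.eventually_ge_atTop (d * Real.logb 2 b + 1)] with n hdn hn
  obtain ⟨l, rfl⟩ := Nat.exists_eq_add_of_le hdn
  have hbl : 1 ≤ b ^ l := one_le_pow₀ hb
  obtain ⟨c, hc⟩ := h l
  refine ⟨_, inferInstance, ⟨⟨0, Nat.floor_pos.2 hbl⟩⟩, c, hc, ?_⟩
  rw [Fintype.card_fin]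
  refine le_trans ?_ (logb_sub_one_le_logb_floor hbl)
  rw [Real.logb_pow]
  push_cast at hn ⊢
  linarith

theorem CausalCode.IsZeroError.exists_forall_exists_code [Fintype U] [Nonempty X] [Nonempty S]
    (hg : Function.Surjective g) {P : stdSimplex ℝ U} (hv₀ : 0 < v) (hv₁ : v < 1)
    (hP : ∀ y, mass P (CanOutput W g · y) ≤ v) {M : Type*} [Finite M] [Nontrivial M] {k : ℕ}
    {c : CausalCode X S Y k M} (hc : c.IsZeroError W) :
    ∃ d, ∀ l, ∃ c : CausalCode X S Y (d + l) (Fin ⌊v⁻¹ ^ l⌋₊), c.IsZeroError W := by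
  have := Fintype.ofFinite M
  obtain ⟨t, ht⟩ := pow_unbounded_of_one_lt (1 + Fintype.card U / (1 - v))
    (Nat.one_lt_cast (α := ℝ).2 (Fintype.one_lt_card (α := M)))
  refine ⟨t * k, fun l => exists_isZeroError_of_canReduce (g := g) (.trans ?_)⟩
  have hU : 0 ≤ Fintype.card U / (1 - v) := div_nonneg (Nat.cast_nonneg _) (sub_nonneg.2 hv₁.le)
  have hcard : ((Finset.univ : Finset (Fin ⌊v⁻¹ ^ l⌋₊)).card : ℝ)
      ≤ v⁻¹ ^ l + Fintype.card U / (1 - v) := by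
    rw [Finset.card_fin]
    exact (Nat.floor_le (by positivity)).trans (le_add_of_nonneg_right hU)
  refine (canReduce_card_le hv₀.le hv₁ hP l hcard).mono fun A hA =>
    canReduce_of_card_le_pow (hc.canReduce hg) t ?_
  rw [← mul_pow, mul_inv_cancel₀ hv₀.ne', one_pow] at hA
  exact_mod_cast hA.trans ht.le

end Achievability

theorem capacity_eq_neg_logb [Fintype U] [Nonempty S] (hg : Function.Surjective g)
    (h : 0 < capacity W) {P : stdSimplex ℝ U} {q : stdSimplex ℝ Y}
    (hs : IsSaddle (CanOutput W g) P q v) (hv : 0 < v) :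
    capacity W = ((-Real.logb 2 v : ℝ) : EReal) := by
  have : Nonempty X := nonempty_of_capacity_pos h
  obtain ⟨k, -, M, _, _, c, hc⟩ := exists_code_of_capacity_pos h
  have hv₁ : v < 1 := hc.lt_one hg hv.le hs.le_mass
  obtain ⟨d, hd⟩ := hc.exists_forall_exists_code hg hv hv₁ hs.mass_le
  apply le_antisymm
  · rw [capacity, sSup_image, iSup₂_le_iff]
    exact fun R hR => EReal.coe_le_coe_iff.2 (hR.le_neg_logb hg hv hs.le_mass)
  · refine EReal.ge_of_forall_gt_iff_ge.1 fun R hR => le_sSup ⟨R, ?_, rfl⟩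
    refine isAchievable_of_forall_exists_code ((one_le_inv₀ hv).2 hv₁.le) hd ?_
    rwa [Real.logb_inv, ← EReal.coe_lt_coe_iff]

end Capacity

end CausalZeroError

open CausalZeroError in
theorem mainTheorem6_general {X S Y U : Type*} [Fintype S] [Fintype Y] [Fintype U]
    (Q : stdSimplex ℝ S) (hQ : ∀ s, 0 < Q s) (W : SDChannel X S Y)
    (g : U → S → X) (hg : Function.Surjective g) :
    (0 < capacity W →
      IsMaxMin
        (fun (P : stdSimplex ℝ U) (V : dominatedBy (inducedChannel Q W g)) =>
          ((mutualInfo fun u y => P u * V.1 u y : ℝ) : EReal))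
        (capacity W) ∧
      IsMaxMin
        (fun (P : stdSimplex ℝ U) (y : Y) =>
          negLog (∑ u : U with 0 < inducedChannel Q W g u y, P u))
        (capacity W)) ∧
    (∀ u y, 0 < inducedChannel Q W g u y ↔ ∃ s, 0 < W (g u s) s y) ∧
    (∀ V : U → stdSimplex ℝ Y,
      V ∈ dominatedBy (inducedChannel Q W g) ↔
        ∀ u y, (∀ s, W (g u s) s y = 0) → V u y = 0) := by
  have hE : (fun u y => 0 < inducedChannel Q W g u y) = CanOutput W g :=
    funext₂ fun u y => propext (inducedChannel_pos_iff hQ u y)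
  refine ⟨fun hpos => ?_, fun u y => inducedChannel_pos_iff hQ u y, fun V => ?_⟩
  · have : Nonempty S := nonempty_of_pmf Q
    have : Nonempty X := nonempty_of_capacity_pos hpos
    have : Nonempty U := hg.nonempty
    have : Nonempty Y := nonempty_of_pmf (inducedChannel Q W g (Classical.arbitrary U))
    obtain ⟨P, q, v, hs⟩ := exists_isSaddle fun u y => 0 < inducedChannel Q W g u y
    have hv : 0 < v := hs.pos fun u => exists_pmf_pos (inducedChannel Q W g u)
    rw [capacity_eq_neg_logb hg hpos (hE ▸ hs) hv]
    refine ⟨isMaxMin_mutualInfo hs, ?_⟩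
    rw [← negLog_of_pos hv]
    simpa only [mass] using! isMaxMin_negLog_mass hs hv.le
  · simp only [mem_dominatedBy_iff, inducedChannel_pos_iff hQ, CanOutput, not_exists,
      (stdSimplex.zero_le (W _ _) _).not_lt_iff_eq']

theorem mainTheorem6 {X S Y U : Type*} [Fintype X] [Fintype S] [Fintype Y] [Fintype U]
    (Q : stdSimplex ℝ S) (hQ : ∀ s, 0 < Q s)
    (W : CausalZeroError.SDChannel X S Y)
    (g : U → S → X) (hU : Fintype.card U = Fintype.card X ^ Fintype.card S)
    (hg : Set.range g = Set.univ) :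
    (0 < CausalZeroError.capacity W →
      CausalZeroError.IsMaxMin
        (fun (P : stdSimplex ℝ U)
            (V : CausalZeroError.dominatedBy (CausalZeroError.inducedChannel Q W g)) =>
          ((CausalZeroError.mutualInfo fun u y => P u * V.1 u y : ℝ) : EReal))
        (CausalZeroError.capacity W) ∧
      CausalZeroError.IsMaxMin
        (fun (P : stdSimplex ℝ U) (y : Y) =>
          CausalZeroError.negLog
            (∑ u : U with 0 < CausalZeroError.inducedChannel Q W g u y, P u))
        (CausalZeroError.capacity W)) ∧
    (∀ u y, 0 < CausalZeroError.inducedChannel Q W g u y ↔ ∃ s, 0 < W (g u s) s y) ∧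
    (∀ V : U → stdSimplex ℝ Y,
      V ∈ CausalZeroError.dominatedBy (CausalZeroError.inducedChannel Q W g) ↔
        ∀ u y, (∀ s, W (g u s) s y = 0) → V u y = 0) :=
  mainTheorem6_general Q hQ W g (Set.range_eq_univ.1 hg)
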